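/- Let $\{b_k\}_{k\ge1}$, $\{p_k\}_{k\ge1}$, $\{t_k\}_{k\ge1}$ be sequences of integers with $|b_k|\ge2$, $p_k\ge2$ and $|t_k|\ge1$ for all $k$, and suppose that the sequence $\{p_kt_k\}_{k\ge1}$ is bounded. Put $D_k=\{0,1,\dots,p_k-1\}\,t_k$. For a finite non-empty set $E\subset\mathbb R$ let $\delta_E=\frac1{\#E}\sum_{e\in E}\delta_e$, and let $\mu$ be the Moran measure $$\mu=\delta_{b_1^{-1}D_1}*\delta_{(b_1b_2)^{-1}D_2}*\delta_{(b_1b_2b_3)^{-1}D_3}*\cdots,$$ that is, the weak limit of the finite convolutions. For $k\ge1$ let $$\nu_{>k}=\delta_{b_{k+1}^{-1}D_{k+1}}*\delta_{(b_{k+1}b_{k+2})^{-1}D_{k+2}}*\delta_{(b_{k+1}b_{k+2}b_{k+3})^{-1}D_{k+3}}*\cdots$$ (again a weak limit). A compactly supported Borel probability measure $\rho$ on $\mathbb R$ is called a spectral measure if there is a countable discrete set $\Lambda\subset\mathbb R$ such that $\{e^{2\pi i\lambda x}:\lambda\in\Lambda\}$ is an orthogonal basis of $L^2(\rho)$. Suppose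 that $p_k\nmid t_{k+1}$ for all $k\ge1$ and that $\mu$ is a spectral measure. Then for every $k\ge1$ one has $p_{k+1}\mid b_{k+1}t_k$, and $\nu_{>k}$ is a spectral measure. -/

import Mathlib

open MeasureTheory ProbabilityTheory Filter Topology
open scoped ENNReal BoundedContinuousFunction

/-- The uniform probability measure `δ_E = (1 / #E) ∑ e ∈ E, δ_e` on a finite set `E ⊂ ℝ`. -/
noncomputable def uniformMeasure (E : Finset ℝ) : Measure ℝ :=
  (E.card : ℝ≥0∞)⁻¹ • ∑ e ∈ E, Measure.dirac e

/-- The convolution `ρ 0 ∗ ρ 1 ∗ ⋯ ∗ ρ (k - 1)` of the first `k` terms of a sequence of measures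
(the unit mass at `0` for `k = 0`). -/
noncomputable def partialConvolution (ρ : ℕ → Measure ℝ) : ℕ → Measure ℝ
  | 0 => Measure.dirac 0
  | k + 1 => partialConvolution ρ k ∗ ρ k

/-- Weak convergence of measures on `ℝ`, tested on bounded continuous functions. -/
def ConvergesWeakly (m : ℕ → Measure ℝ) (μ : Measure ℝ) : Prop :=
  ∀ f : ℝ →ᵇ ℝ, Tendsto (fun k => ∫ x, f x ∂(m k)) atTop (𝓝 (∫ x, f x ∂μ))

open Classical in
/-- The infinite convolution `ρ 0 ∗ ρ 1 ∗ ρ 2 ∗ ⋯`: the probability measure that is the weak limit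
of the finite convolutions (and `0` if there is no such limit). -/
noncomputable def infiniteConvolution (ρ : ℕ → Measure ℝ) : Measure ℝ :=
  if h : ∃ μ : Measure ℝ, IsProbabilityMeasure μ ∧ ConvergesWeakly (partialConvolution ρ) μ then
    h.choose
  else 0

/-- The finite set `(b 0 * b 1 * ⋯ * b k)⁻¹ D k` of real numbers. -/
noncomputable def scaledDigits (b : ℕ → ℤ) (D : ℕ → Finset ℤ) (k : ℕ) : Finset ℝ :=
  (D k).image fun d : ℤ => (∏ i ∈ Finset.range (k + 1), (b i : ℝ))⁻¹ * (d : ℝ)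

/-- The Moran measure
`δ_{(b 0)⁻¹ D 0} ∗ δ_{(b 0 * b 1)⁻¹ D 1} ∗ δ_{(b 0 * b 1 * b 2)⁻¹ D 2} ∗ ⋯`.
Sequences are indexed from `0`: the first term of each sequence has index `0`. -/
noncomputable def moranMeasure (b : ℕ → ℤ) (D : ℕ → Finset ℤ) : Measure ℝ :=
  infiniteConvolution fun k => uniformMeasure (scaledDigits b D k)

/-- The tail measure `ν_{>k}`: the Moran measure of the sequences with their first `k` terms
deleted. -/
noncomputable def moranTail (b : ℕ → ℤ) (D : ℕ → Finset ℤ) (k : ℕ) : Measure ℝ :=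
  moranMeasure (fun n => b (k + n)) (fun n => D (k + n))

/-- The digit set `{0, 1, …, p - 1} t`. -/
def consecutiveDigits (p : ℕ) (t : ℤ) : Finset ℤ :=
  (Finset.range p).image fun j : ℕ => (j : ℤ) * t

/-- `Λ` is a spectrum of `μ`: a countable discrete set such that the exponentials
`x ↦ exp (2 π i l x)`, `l ∈ Λ`, form an orthonormal (Hilbert) basis of `L²(μ)`.  For a probability
measure every exponential has norm one, so orthogonal and orthonormal mean the same here. -/
structure IsSpectrum (μ : Measure ℝ) (Λ : Set ℝ) : Prop where
  countable : Λ.Countable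
  discrete : IsDiscrete Λ
  basis : ∃ B : HilbertBasis Λ ℂ (Lp ℂ 2 μ), ∀ l : Λ,
    (B l : ℝ → ℂ) =ᵐ[μ] fun x => Complex.exp (2 * Real.pi * Complex.I * ((l : ℝ) : ℂ) * (x : ℂ))

/-- A spectral measure: a Borel probability measure on `ℝ` with compact support that has a
spectrum. -/
structure IsSpectralMeasure (μ : Measure ℝ) : Prop where
  isProbabilityMeasure : IsProbabilityMeasure μ
  isCompact_support : IsCompact μ.support
  exists_spectrum : ∃ Λ : Set ℝ, IsSpectrum μ Λ

/-! The weak limits above exist and are unique. -/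

theorem isProbabilityMeasure_uniformMeasure {E : Finset ℝ} (hE : E.Nonempty) :
    IsProbabilityMeasure (uniformMeasure E) := by
  constructor
  have h0 : (E.card : ℝ≥0∞) ≠ 0 := by simpa using hE.ne_empty
  simp [uniformMeasure, Measure.smul_apply, ENNReal.inv_mul_cancel h0 (ENNReal.natCast_ne_top _)]

theorem ae_mem_uniformMeasure (E : Finset ℝ) : ∀ᵐ x ∂(uniformMeasure E), x ∈ E := by
  refine Measure.ae_smul_measure ?_ _
  rw [ae_iff, Measure.coe_finsetSum, Finset.sum_apply]
  refine Finset.sum_eq_zero fun e he => ?_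
  have hm : MeasurableSet {x : ℝ | x ∉ E} := E.measurableSet.compl
  rw [Measure.dirac_apply' _ hm]
  simp [he]

/-- The finite convolutions are the laws of the partial sums of independent variables. -/
theorem map_sum_infinitePi (ρ : ℕ → Measure ℝ) (hρ : ∀ k, IsProbabilityMeasure (ρ k)) (n : ℕ) :
    (Measure.infinitePi ρ).map (fun ω : ℕ → ℝ => ∑ k ∈ Finset.range n, ω k) =
      partialConvolution ρ n := by
  have hind : iIndepFun (fun (k : ℕ) (ω : ℕ → ℝ) => ω k) (Measure.infinitePi ρ) :=
    iIndepFun_infinitePi (P := ρ) (X := fun _ x => x) fun _ => measurable_id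
  induction n with
  | zero => simp [partialConvolution]
  | succ n ih =>
    have h1 := hind.indepFun_sum_range_succ (fun k => measurable_pi_apply k) n
    have h2 : (∑ k ∈ Finset.range n, fun ω : ℕ → ℝ => ω k) =
        fun ω : ℕ → ℝ => ∑ k ∈ Finset.range n, ω k := by
      ext ω
      simp
    rw [h2] at h1
    have h3 := h1.map_add_eq_map_conv_map
      (Finset.measurable_fun_sum _ fun k _ => measurable_pi_apply k) (measurable_pi_apply n)
    rw [ih, Measure.infinitePi_map_eval] at h3
    rw [partialConvolution, ← h3]
    congr 1
    ext ω
    simp [Finset.sum_range_succ]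

/-- If `ρ k` is carried by `[-C k, C k]` with `∑ C k < ∞`, then the finite convolutions converge
weakly. -/
theorem exists_weakLimit (ρ : ℕ → Measure ℝ) (hρ : ∀ k, IsProbabilityMeasure (ρ k))
    (C : ℕ → ℝ) (hC : Summable C) (hb : ∀ k, ∀ᵐ x ∂(ρ k), |x| ≤ C k) :
    ∃ μ : Measure ℝ, IsProbabilityMeasure μ ∧ ConvergesWeakly (partialConvolution ρ) μ := by
  have hS : ∀ n, Measurable fun ω : ℕ → ℝ => ∑ k ∈ Finset.range n, ω k := fun n =>
    Finset.measurable_fun_sum _ fun k _ => measurable_pi_apply k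
  have hae : ∀ᵐ ω ∂(Measure.infinitePi ρ), ∀ k, |ω k| ≤ C k := by
    rw [ae_all_iff]
    exact fun k => (measurePreserving_eval_infinitePi ρ k).quasiMeasurePreserving.ae (hb k)
  have hlim : ∀ᵐ ω ∂(Measure.infinitePi ρ),
      Tendsto (fun n => ∑ k ∈ Finset.range n, ω k) atTop (𝓝 (∑' k, ω k)) := by
    filter_upwards [hae] with ω hω
    have hsum : Summable ω := Summable.of_norm_bounded hC hω
    exact hsum.hasSum.tendsto_sum_nat
  have hmeas : AEMeasurable (fun ω : ℕ → ℝ => ∑' k, ω k) (Measure.infinitePi ρ) :=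
    aemeasurable_of_tendsto_metrizable_ae' (fun n => (hS n).aemeasurable) hlim
  refine ⟨(Measure.infinitePi ρ).map fun ω => ∑' k, ω k,
    Measure.isProbabilityMeasure_map hmeas, fun f => ?_⟩
  rw [integral_map hmeas f.continuous.aestronglyMeasurable]
  have hEq : ∀ n, ∫ x, f x ∂(partialConvolution ρ n) =
      ∫ ω, f (∑ k ∈ Finset.range n, ω k) ∂(Measure.infinitePi ρ) := by
    intro n
    rw [← map_sum_infinitePi ρ hρ n,
      integral_map (hS n).aemeasurable f.continuous.aestronglyMeasurable]
  simp_rw [hEq]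
  refine tendsto_integral_of_dominated_convergence (fun _ => ‖f‖) (fun n => ?_)
    (integrable_const _) (fun n => ae_of_all _ fun ω => f.norm_coe_le_norm _) ?_
  · exact (f.continuous.measurable.comp (hS n)).aestronglyMeasurable
  · filter_upwards [hlim] with ω hω
    exact (f.continuous.tendsto _).comp hω

theorem infiniteConvolution_spec {ρ : ℕ → Measure ℝ}
    (h : ∃ μ : Measure ℝ, IsProbabilityMeasure μ ∧ ConvergesWeakly (partialConvolution ρ) μ) :
    IsProbabilityMeasure (infiniteConvolution ρ) ∧
      ConvergesWeakly (partialConvolution ρ) (infiniteConvolution ρ) := by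
  rw [infiniteConvolution, dif_pos h]
  exact h.choose_spec

theorem infiniteConvolution_eq {ρ : ℕ → Measure ℝ} {μ : Measure ℝ} (hμ : IsProbabilityMeasure μ)
    (h : ConvergesWeakly (partialConvolution ρ) μ) : infiniteConvolution ρ = μ := by
  obtain ⟨h1, h2⟩ := infiniteConvolution_spec ⟨μ, hμ, h⟩
  exact ext_of_forall_integral_eq_of_IsFiniteMeasure fun f => tendsto_nhds_unique (h2 f) (h f)

/-- For integers `|b k| ≥ 2` and uniformly bounded non-empty digit sets, the Moran measure is a
probability measure and the weak limit of the finite convolutions. -/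
theorem moranMeasure_spec (b : ℕ → ℤ) (D : ℕ → Finset ℤ) (hb : ∀ k, 2 ≤ |b k|)
    (hD : ∀ k, (D k).Nonempty) (M : ℤ) (hM : ∀ k, ∀ d ∈ D k, |d| ≤ M) :
    IsProbabilityMeasure (moranMeasure b D) ∧
      ConvergesWeakly (partialConvolution fun k => uniformMeasure (scaledDigits b D k))
        (moranMeasure b D) := by
  refine infiniteConvolution_spec (exists_weakLimit _
    (fun k => isProbabilityMeasure_uniformMeasure ((hD k).image _))
    (fun k => (1 / 2 : ℝ) ^ (k + 1) * M) ?_ fun k => ?_)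
  · exact ((summable_nat_add_iff 1).2 summable_geometric_two).mul_right _
  · filter_upwards [ae_mem_uniformMeasure (scaledDigits b D k)] with x hx
    obtain ⟨d, hd, rfl⟩ := Finset.mem_image.1 hx
    have hd' : |(d : ℝ)| ≤ M := by exact_mod_cast hM k d hd
    have hprod : (2 : ℝ) ^ (k + 1) ≤ ∏ i ∈ Finset.range (k + 1), |(b i : ℝ)| := by
      calc (2 : ℝ) ^ (k + 1) = ∏ i ∈ Finset.range (k + 1), (2 : ℝ) := by simp
        _ ≤ _ := Finset.prod_le_prod (fun _ _ => by norm_num) fun i _ => by exact_mod_cast hb i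
    rw [abs_mul, abs_inv, Finset.abs_prod]
    refine mul_le_mul ?_ hd' (abs_nonneg _) (by positivity)
    rw [one_div, inv_pow]
    exact inv_anti₀ (by positivity) hprod

/-! The transform of μ factors as φ(ξ) = m(sξ) ψ(ξ), where m is the mask of {0, …, p - 1} and ψ is a
rescaled transform of the next tail. An orthogonal set is a spectrum exactly when its energy ∑ |φ(l
- ξ)|² is 1 for every ξ, and a dense set of ξ suffices (`IsSpectrum.energy_eq_one`,
`isSpectrum_of_energy`).

Group a spectrum Λ into classes of s·l modulo (1/p)ℤ and cut each class into p cells modulo ℤ. The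
zeros of m lie in (1/p)ℤ \ ℤ, so keeping one cell per class leaves a ψ-orthogonal set, of energy at
most 1. The φ-energy 1 of Λ is a sum over classes of weighted averages of the ψ-energies of the
cells, the weights |m|² adding up to 1 in each class. Keeping the heaviest cells also gives at most
1, so each average equals its maximum. At generic ξ the weights are positive: the cells of a class
have equal energy, and every choice of cells has energy 1 (`cellSum_eq`, `energy_selection`). Hence
the tail is spectral, and induction gives all tails.

For the divisibility, split off two masks, with 0 ∈ Λ, and compare two choices of cells for the
first mask that differ only in the class of 0. Balance of the cells of the second mask must hold for
both. If the two frequency lattices had no relation, the term of frequency 0 would be left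
uncompensated (`exists_lattice_relation`). One possible relation gives p_{k+1} ∣ b_{k+1} t_k, the
other p_k ∣ t_{k+1}, which is excluded. This is applied to every tail. -/

/-! ### Exponentials and Fourier transforms -/

/-- The exponential `x ↦ exp (2 π i l x)`. -/
noncomputable def expFun (l x : ℝ) : ℂ := Complex.exp (2 * Real.pi * Complex.I * (l : ℂ) * (x : ℂ))

/-- The Fourier transform `l ↦ ∫ exp (2 π i l x) dμ(x)` of a measure. -/
noncomputable def fourierTransform (μ : Measure ℝ) (l : ℝ) : ℂ := ∫ x, expFun l x ∂μ

theorem norm_expFun (l x : ℝ) : ‖expFun l x‖ = 1 := by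
  have : 2 * Real.pi * Complex.I * (l : ℂ) * (x : ℂ) = ((2 * Real.pi * l * x : ℝ) : ℂ) * Complex.I := by
    push_cast; ring
  rw [expFun, this, Complex.norm_exp_ofReal_mul_I]

theorem expFun_add (l l' x : ℝ) : expFun (l + l') x = expFun l x * expFun l' x := by
  rw [expFun, expFun, expFun, ← Complex.exp_add]
  push_cast; ring_nf

theorem conj_expFun (l x : ℝ) : (starRingEnd ℂ) (expFun l x) = expFun (-l) x := by
  rw [expFun, expFun, ← Complex.exp_conj]
  congr 1
  have h2 : (starRingEnd ℂ) (2 : ℂ) = 2 := by simpa using Complex.conj_ofReal 2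
  simp only [map_mul, Complex.conj_ofReal, Complex.conj_I, h2, Complex.ofReal_neg]
  ring

@[fun_prop]
theorem continuous_expFun (l : ℝ) : Continuous (expFun l) := by
  unfold expFun; fun_prop

@[fun_prop]
theorem continuous_expFun_left (x : ℝ) : Continuous fun l => expFun l x := by
  unfold expFun; fun_prop

theorem fourierTransform_eq_charFun (μ : Measure ℝ) (l : ℝ) :
    fourierTransform μ l = charFun μ (2 * Real.pi * l) := by
  rw [fourierTransform, charFun_apply_real]
  refine integral_congr_ae (ae_of_all _ fun x => ?_)
  simp only [expFun]
  push_cast; ring_nf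

theorem integrable_expFun (μ : Measure ℝ) [IsFiniteMeasure μ] (l : ℝ) : Integrable (expFun l) μ :=
  (integrable_const (1 : ℝ)).mono' (continuous_expFun l).aestronglyMeasurable
    (ae_of_all _ fun x => (norm_expFun l x).le)

theorem memLp_expFun (μ : Measure ℝ) [IsFiniteMeasure μ] (l : ℝ) : MemLp (expFun l) 2 μ :=
  MemLp.of_bound (continuous_expFun l).aestronglyMeasurable 1
    (ae_of_all _ fun x => (norm_expFun l x).le)

theorem norm_fourierTransform_neg (μ : Measure ℝ) (l : ℝ) :
    ‖fourierTransform μ (-l)‖ = ‖fourierTransform μ l‖ := by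
  rw [fourierTransform, fourierTransform]
  simp_rw [← conj_expFun, integral_conj, RCLike.norm_conj]

theorem fourierTransform_zero (μ : Measure ℝ) [IsProbabilityMeasure μ] :
    fourierTransform μ 0 = 1 := by
  simp [fourierTransform, expFun]

theorem continuous_fourierTransform (μ : Measure ℝ) [IsFiniteMeasure μ] :
    Continuous (fourierTransform μ) := by
  refine continuous_of_dominated (F := fun l x => expFun l x) (bound := fun _ => 1)
    (fun l => (continuous_expFun l).aestronglyMeasurable)
    (fun l => ae_of_all _ fun x => (norm_expFun l x).le) (integrable_const _)
    (ae_of_all _ continuous_expFun_left)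

/-- The exponential `x ↦ exp (2 π i l x)` as an element of `L²(μ)`. -/
noncomputable def expLp (μ : Measure ℝ) [IsFiniteMeasure μ] (l : ℝ) : Lp ℂ 2 μ :=
  (memLp_expFun μ l).toLp (expFun l)

theorem coeFn_expLp (μ : Measure ℝ) [IsFiniteMeasure μ] (l : ℝ) :
    (expLp μ l : ℝ → ℂ) =ᵐ[μ] expFun l := MemLp.coeFn_toLp _

theorem inner_expLp_left (μ : Measure ℝ) [IsFiniteMeasure μ] (l : ℝ) (f : Lp ℂ 2 μ) :
    inner ℂ (expLp μ l) f = ∫ x, expFun (-l) x * f x ∂μ := by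
  rw [L2.inner_def]
  refine integral_congr_ae ?_
  filter_upwards [coeFn_expLp μ l] with x hx
  rw [hx, RCLike.inner_apply, conj_expFun, mul_comm]

theorem inner_expLp (μ : Measure ℝ) [IsFiniteMeasure μ] (l l' : ℝ) :
    inner ℂ (expLp μ l) (expLp μ l') = fourierTransform μ (l' - l) := by
  rw [inner_expLp_left, fourierTransform]
  refine integral_congr_ae ?_
  filter_upwards [coeFn_expLp μ l'] with x hx
  rw [hx, ← expFun_add]
  ring_nf

theorem norm_expLp (μ : Measure ℝ) [IsProbabilityMeasure μ] (l : ℝ) : ‖expLp μ l‖ = 1 := by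
  have := inner_self_eq_norm_sq_to_K (𝕜 := ℂ) (expLp μ l)
  rw [inner_expLp, sub_self, fourierTransform_zero] at this
  have h2 : ‖expLp μ l‖ ^ 2 = 1 := Complex.ofReal_injective (by simpa using this.symm)
  exact (pow_eq_one_iff_of_nonneg (norm_nonneg _) two_ne_zero).1 h2

/-- The positive and negative parts of `g` are densities of finite measures with the same
characteristic function, so these measures agree. -/
theorem ae_eq_zero_of_integral_expFun_real (μ : Measure ℝ) [IsFiniteMeasure μ] (g : ℝ → ℝ)
    (hgi : Integrable g μ)
    (h : ∀ l, ∫ x, expFun l x * (g x : ℂ) ∂μ = 0) : g =ᵐ[μ] 0 := by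
  have hm : AEMeasurable g μ := hgi.aestronglyMeasurable.aemeasurable
  have key : ∀ f : ℝ → ℝ, Integrable f μ → ∀ l,
      fourierTransform (μ.withDensity fun x => ENNReal.ofReal (f x)) l =
        ∫ x, expFun l x * ((max (f x) 0 : ℝ) : ℂ) ∂μ := by
    intro f hf l
    rw [fourierTransform, integral_withDensity_eq_integral_toReal_smul₀
      hf.aestronglyMeasurable.aemeasurable.ennreal_ofReal (by simp)]
    refine integral_congr_ae (ae_of_all _ fun x => ?_)
    simp only [ENNReal.toReal_ofReal', Complex.real_smul, mul_comm]
  have hint : ∀ f : ℝ → ℝ, Integrable f μ → ∀ l,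
      Integrable (fun x => expFun l x * ((max (f x) 0 : ℝ) : ℂ)) μ := by
    intro f hf l
    refine hf.pos_part.ofReal.bdd_mul (c := 1) (continuous_expFun l).aestronglyMeasurable
      (ae_of_all _ fun x => (norm_expFun l x).le)
  have hf1 : IsFiniteMeasure (μ.withDensity fun x => ENNReal.ofReal (g x)) :=
    isFiniteMeasure_withDensity_ofReal hgi.2
  have hf2 : IsFiniteMeasure (μ.withDensity fun x => ENNReal.ofReal (-g x)) :=
    isFiniteMeasure_withDensity_ofReal hgi.neg.2
  have heq : (μ.withDensity fun x => ENNReal.ofReal (g x)) =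
      μ.withDensity fun x => ENNReal.ofReal (-g x) := by
    refine Measure.ext_of_charFun (funext fun t => ?_)
    obtain ⟨l, rfl⟩ : ∃ l, t = 2 * Real.pi * l := ⟨t / (2 * Real.pi), by field_simp⟩
    rw [← fourierTransform_eq_charFun, ← fourierTransform_eq_charFun, key g hgi,
      key (fun x => -g x) hgi.neg, ← sub_eq_zero, ← integral_sub (hint g hgi l) (hint (fun x => -g x) hgi.neg l), ← h l]
    refine integral_congr_ae (ae_of_all _ fun x => ?_)
    simp only
    rw [← mul_sub, ← Complex.ofReal_sub, max_zero_sub_max_neg_zero_eq_self]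
  rw [withDensity_eq_iff hm.ennreal_ofReal
    (AEMeasurable.ennreal_ofReal (f := fun x => -g x) hm.neg)] at heq
  · filter_upwards [heq] with x hx
    rcases le_total (g x) 0 with h0 | h0
    · rw [ENNReal.ofReal_of_nonpos h0, eq_comm, ENNReal.ofReal_eq_zero] at hx
      simp only [Pi.zero_apply]; linarith
    · rw [ENNReal.ofReal_of_nonpos (neg_nonpos.2 h0), ENNReal.ofReal_eq_zero] at hx
      simp only [Pi.zero_apply]; linarith
  · have := hf1.measure_univ_lt_top.ne
    rwa [withDensity_apply _ MeasurableSet.univ, Measure.restrict_univ] at this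

theorem eq_zero_of_inner_expLp (μ : Measure ℝ) [IsFiniteMeasure μ] (f : Lp ℂ 2 μ)
    (h : ∀ l, inner ℂ (expLp μ l) f = 0) : f = 0 := by
  have hfi : Integrable f μ := (Lp.memLp f).integrable (by norm_num)
  have h1 : ∀ l, ∫ x, expFun l x * f x ∂μ = 0 := fun l => by
    rw [← h (-l), inner_expLp_left, neg_neg]
  have h2 : ∀ l, ∫ x, expFun l x * (starRingEnd ℂ) (f x) ∂μ = 0 := fun l => by
    have := congrArg (starRingEnd ℂ) (h1 (-l))
    rw [← integral_conj, map_zero] at this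
    rw [← this]
    simp [conj_expFun]
  have hci : Integrable (fun x => (starRingEnd ℂ) (f x)) μ :=
    (RCLike.conjLIE (K := ℂ)).integrable_comp_iff.2 hfi
  have hb : ∀ l {g : ℝ → ℂ}, Integrable g μ → Integrable (fun x => expFun l x * g x) μ :=
    fun l g hg => hg.bdd_mul (c := 1) (continuous_expFun l).aestronglyMeasurable
      (ae_of_all _ fun x => (norm_expFun l x).le)
  have hre : (fun x => (f x).re) =ᵐ[μ] 0 := by
    refine ae_eq_zero_of_integral_expFun_real μ _ hfi.re fun l => ?_
    have : ∀ x, expFun l x * ((f x).re : ℂ) =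
        (1 / 2 : ℂ) * (expFun l x * f x + expFun l x * (starRingEnd ℂ) (f x)) := fun x => by
      rw [Complex.re_eq_add_conj]; ring
    simp_rw [this]
    rw [integral_const_mul, integral_add (hb l hfi) (hb l hci), h1, h2]; simp
  have him : (fun x => (f x).im) =ᵐ[μ] 0 := by
    refine ae_eq_zero_of_integral_expFun_real μ _ hfi.im fun l => ?_
    have : ∀ x, expFun l x * ((f x).im : ℂ) =
        (1 / (2 * Complex.I) : ℂ) * (expFun l x * f x - expFun l x * (starRingEnd ℂ) (f x)) :=
      fun x => by rw [Complex.im_eq_sub_conj]; ring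
    simp_rw [this]
    rw [integral_const_mul, integral_sub (hb l hfi) (hb l hci), h1, h2]; simp
  rw [Lp.eq_zero_iff_ae_eq_zero]
  filter_upwards [hre, him] with x h1 h2
  exact Complex.ext h1 h2

/-! ### Orthogonality, energy and spectra -/

/-- The exponentials with frequencies in `T` are orthogonal for a measure with Fourier
transform `φ`. -/
def IsOrthogonalSet (φ : ℝ → ℂ) (T : Set ℝ) : Prop :=
  ∀ l ∈ T, ∀ l' ∈ T, l ≠ l' → φ (l - l') = 0

/-- The sum `∑ l ∈ T, |φ (l - ξ)|²`. -/
noncomputable def energy (φ : ℝ → ℂ) (T : Set ℝ) (ξ : ℝ) : ℝ≥0∞ := ∑' l : T, ‖φ (l - ξ)‖ₑ ^ 2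

theorem ENNReal.tsum_option {ι : Type*} (f : Option ι → ℝ≥0∞) :
    ∑' o, f o = f none + ∑' i, f (some i) := by
  rw [← (Equiv.optionEquivSumPUnit.{0} ι).symm.tsum_eq f,
    Summable.tsum_sum ENNReal.summable ENNReal.summable, add_comm]
  simp

theorem IsOrthogonalSet.orthonormal {μ : Measure ℝ} [IsProbabilityMeasure μ] {T : Set ℝ}
    (h : IsOrthogonalSet (fourierTransform μ) T) : Orthonormal ℂ fun l : T => expLp μ l :=
  ⟨fun l => norm_expLp μ l, fun l l' hne => by
    simp only [inner_expLp]; exact h _ l'.2 _ l.2 fun e => hne (Subtype.ext e.symm)⟩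

theorem enorm_sq_eq_ofReal (z : ℂ) : ‖z‖ₑ ^ 2 = ENNReal.ofReal (‖z‖ ^ 2) := by
  rw [ENNReal.ofReal_pow (norm_nonneg _), ofReal_norm]

theorem Orthonormal.tsum_enorm_inner_sq_le {E ι : Type*} [NormedAddCommGroup E]
    [InnerProductSpace ℂ E] {v : ι → E} (hv : Orthonormal ℂ v) (x : E) :
    ∑' i, ‖inner ℂ (v i) x‖ₑ ^ 2 ≤ ENNReal.ofReal (‖x‖ ^ 2) := by
  simp_rw [enorm_sq_eq_ofReal]
  rw [← ENNReal.ofReal_tsum_of_nonneg (fun i => by positivity) (hv.inner_products_summable x)]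
  exact ENNReal.ofReal_le_ofReal (hv.tsum_inner_products_le x)

theorem energy_eq_tsum_inner (μ : Measure ℝ) [IsFiniteMeasure μ] (T : Set ℝ) (ξ : ℝ) :
    energy (fourierTransform μ) T ξ = ∑' l : T, ‖inner ℂ (expLp μ l) (expLp μ ξ)‖ₑ ^ 2 := by
  refine tsum_congr fun l => ?_
  rw [inner_expLp, ← ofReal_norm, ← ofReal_norm, ← norm_fourierTransform_neg,
    neg_sub]

theorem IsOrthogonalSet.energy_le_one {μ : Measure ℝ} [IsProbabilityMeasure μ] {T : Set ℝ}
    (h : IsOrthogonalSet (fourierTransform μ) T) (ξ : ℝ) :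
    energy (fourierTransform μ) T ξ ≤ 1 := by
  rw [energy_eq_tsum_inner]
  refine (h.orthonormal.tsum_enorm_inner_sq_le _).trans ?_
  simp [norm_expLp]

theorem IsSpectrum.isOrthogonalSet {μ : Measure ℝ} [IsProbabilityMeasure μ] {Λ : Set ℝ}
    (h : IsSpectrum μ Λ) : IsOrthogonalSet (fourierTransform μ) Λ := by
  obtain ⟨B, hB⟩ := h.basis
  have hBe : ∀ l : Λ, B l = expLp μ l := fun l =>
    Lp.ext ((hB l).trans (coeFn_expLp μ l).symm)
  intro l hl l' hl' hne
  rw [← inner_expLp, ← hBe ⟨l, hl⟩, ← hBe ⟨l', hl'⟩]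
  exact B.orthonormal.2 fun e => hne (congrArg Subtype.val e).symm

theorem IsSpectrum.energy_eq_one {μ : Measure ℝ} [IsProbabilityMeasure μ] {Λ : Set ℝ}
    (h : IsSpectrum μ Λ) (ξ : ℝ) : energy (fourierTransform μ) Λ ξ = 1 := by
  obtain ⟨B, hB⟩ := h.basis
  have hBe : ∀ l : Λ, B l = expLp μ l := fun l =>
    Lp.ext ((hB l).trans (coeFn_expLp μ l).symm)
  rw [energy_eq_tsum_inner]
  have h1 := B.hasSum_inner_mul_inner (expLp μ ξ) (expLp μ ξ)
  rw [inner_self_eq_norm_sq_to_K, norm_expLp] at h1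
  have h2 : HasSum (fun l : Λ => ‖inner ℂ (expLp μ l) (expLp μ ξ)‖ ^ 2) 1 := by
    have h3 := Complex.hasSum_re h1
    convert h3 using 2 with l
    · rw [hBe, ← inner_conj_symm (expLp μ ξ) (expLp μ l), RCLike.conj_mul]
      norm_cast
    · simp
  simp_rw [enorm_sq_eq_ofReal]
  rw [← ENNReal.ofReal_tsum_of_nonneg (fun i => by positivity) h2.summable, h2.tsum_eq]
  simp

/-- A unit vector orthogonal to the system could be added to it; Bessel for the enlarged system,
with energy already 1, makes that vector orthogonal to every exponential with frequency in `S`. By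
continuity and density it is orthogonal to all exponentials, hence zero. -/
theorem isSpectrum_of_energy {μ : Measure ℝ} [IsProbabilityMeasure μ] {Λ : Set ℝ}
    (hc : Λ.Countable) (hd : IsDiscrete Λ) (ho : IsOrthogonalSet (fourierTransform μ) Λ)
    {S : Set ℝ} (hS : Dense S) (he : ∀ ξ ∈ S, energy (fourierTransform μ) Λ ξ = 1) :
    IsSpectrum μ Λ := by
  refine ⟨hc, hd, ?_⟩
  have hbot : (Submodule.span ℂ (Set.range fun l : Λ => expLp μ l))ᗮ = ⊥ := by
    rw [Submodule.eq_bot_iff]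
    intro f hf
    by_contra hf0
    rw [Submodule.mem_orthogonal] at hf
    have hf1 : ∀ l : Λ, inner ℂ (expLp μ l) f = 0 := fun l =>
      hf _ (Submodule.subset_span ⟨l, rfl⟩)
    set g : Lp ℂ 2 μ := ((‖f‖ : ℂ)⁻¹) • f with hg
    have hgn : ‖g‖ = 1 := by
      have : ‖f‖ ≠ 0 := norm_ne_zero_iff.2 hf0
      rw [hg, norm_smul, norm_inv, Complex.norm_real, norm_norm, inv_mul_cancel₀ this]
    have hg1 : ∀ l : Λ, inner ℂ (expLp μ l) g = 0 := fun l => by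
      rw [hg, inner_smul_right, hf1, mul_zero]
    have hon : Orthonormal ℂ fun o : Option Λ => o.elim g fun l => expLp μ l := by
      refine ⟨?_, ?_⟩
      · rintro (_ | l)
        · exact hgn
        · exact norm_expLp μ l
      · rintro (_ | l) (_ | l') hne
        · exact absurd rfl hne
        · exact inner_eq_zero_symm.1 (hg1 l')
        · exact hg1 l
        · exact ho.orthonormal.2 fun e => hne (congrArg some e)
    have hS0 : ∀ ξ ∈ S, inner ℂ (expLp μ ξ) g = 0 := by
      intro ξ hξ
      have hle := hon.tsum_enorm_inner_sq_le (expLp μ ξ)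
      rw [norm_expLp, ENNReal.tsum_option] at hle
      simp only [Option.elim] at hle
      rw [← energy_eq_tsum_inner, he ξ hξ] at hle
      have h0 : ‖inner ℂ g (expLp μ ξ)‖ₑ ^ 2 ≤ 0 :=
        ENNReal.le_of_add_le_add_right ENNReal.one_ne_top (by simpa using hle)
      have h1 : inner ℂ g (expLp μ ξ) = 0 := by simpa using h0
      exact inner_eq_zero_symm.1 h1
    have hgi : Integrable g μ := (Lp.memLp g).integrable (by norm_num)
    have hcont : Continuous fun ξ => inner ℂ (expLp μ ξ) g := by
      simp_rw [inner_expLp_left]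
      refine continuous_of_dominated (F := fun l x => expFun (-l) x * g x)
        (bound := fun x => ‖g x‖)
        (fun l => (continuous_expFun _).aestronglyMeasurable.mul hgi.aestronglyMeasurable)
        (fun l => ae_of_all _ fun x => ?_) hgi.norm (ae_of_all _ fun x => ?_)
      · rw [norm_mul, norm_expFun, one_mul]
      · exact ((continuous_expFun_left x).comp continuous_neg).mul continuous_const
    have hall : (fun ξ => inner ℂ (expLp μ ξ) g) = fun _ => 0 :=
      hcont.ext_on hS continuous_const hS0
    have := eq_zero_of_inner_expLp μ g fun l => congrFun hall l
    rw [this, norm_zero] at hgn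
    exact zero_ne_one hgn
  refine ⟨HilbertBasis.mkOfOrthogonalEqBot ho.orthonormal hbot, fun l => ?_⟩
  rw [HilbertBasis.coe_mkOfOrthogonalEqBot]
  exact coeFn_expLp μ l

/-! ### The Dirichlet mask -/

theorem expFun_eq_one_iff (l x : ℝ) : expFun l x = 1 ↔ ∃ n : ℤ, l * x = n := by
  rw [expFun, Complex.exp_eq_one_iff]
  refine exists_congr fun n => ?_
  have h : (2 * Real.pi * Complex.I : ℂ) ≠ 0 := Complex.two_pi_I_ne_zero
  constructor
  · intro hn
    have : (2 * Real.pi * Complex.I : ℂ) * ((l * x : ℝ) : ℂ) = 2 * Real.pi * Complex.I * (n : ℂ) := by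
      rw [mul_comm _ (n : ℂ), ← hn]; push_cast; ring
    exact_mod_cast mul_left_cancel₀ h this
  · intro hn
    have : ((l * x : ℝ) : ℂ) = n := by exact_mod_cast hn
    rw [← this]; push_cast; ring

theorem expFun_natCast_mul (j : ℕ) (l x : ℝ) : expFun (j * l) x = expFun l x ^ j := by
  rw [expFun, expFun, ← Complex.exp_nat_mul]
  push_cast; ring_nf

theorem expFun_mul_comm (l x y : ℝ) : expFun (l * x) y = expFun l (x * y) := by
  rw [expFun, expFun]
  push_cast; ring_nf

theorem expFun_add_right (l x y : ℝ) : expFun l (x + y) = expFun l x * expFun l y := by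
  rw [expFun, expFun, expFun, ← Complex.exp_add]
  push_cast; ring_nf

/-- The Fourier transform `x ↦ (1 / p) ∑ j < p, exp (2 π i j x)` of the uniform measure on
`{0, 1, …, p - 1}`. -/
noncomputable def dirichletMask (p : ℕ) (x : ℝ) : ℂ :=
  (p : ℂ)⁻¹ * ∑ j ∈ Finset.range p, expFun (j : ℝ) x

theorem dirichletMask_add_int (p : ℕ) (x : ℝ) (n : ℤ) :
    dirichletMask p (x + n) = dirichletMask p x := by
  rw [dirichletMask, dirichletMask]
  congr 1
  refine Finset.sum_congr rfl fun j _ => ?_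
  rw [expFun_add_right, (expFun_eq_one_iff (j : ℝ) n).2 ⟨j * n, by push_cast; ring⟩, mul_one]

/-- The zeros of the mask lie in `(1 / p) ℤ` but not in `ℤ`. -/
theorem dirichletMask_eq_zero {p : ℕ} (hp : 0 < p) {x : ℝ} (h : dirichletMask p x = 0) :
    (∃ n : ℤ, p * x = n) ∧ ∀ n : ℤ, x ≠ n := by
  have hp0 : (p : ℂ) ≠ 0 := by exact_mod_cast hp.ne'
  have hs : ∑ j ∈ Finset.range p, expFun (j : ℝ) x = 0 :=
    (mul_eq_zero.1 h).resolve_left (inv_ne_zero hp0)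
  have hpow : ∀ j : ℕ, expFun (j : ℝ) x = expFun 1 x ^ j := fun j => by
    rw [← expFun_natCast_mul, mul_one]
  constructor
  · rw [← expFun_eq_one_iff, hpow, ← sub_eq_zero, ← geom_sum_mul]
    simp_rw [hpow] at hs
    rw [hs, zero_mul]
  · rintro n rfl
    have h1 : ∀ j ∈ Finset.range p, expFun (j : ℝ) (n : ℝ) = 1 := fun j _ =>
      (expFun_eq_one_iff (j : ℝ) n).2 ⟨j * n, by push_cast; ring⟩
    rw [Finset.sum_congr rfl h1] at hs
    simp at hs
    omega

theorem sum_expFun_div {p : ℕ} {j k : ℕ} (hj : j < p) (hk : k < p) :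
    ∑ r ∈ Finset.range p, expFun ((j : ℝ) - k) (r / p) = if j = k then (p : ℂ) else 0 := by
  have hp0 : (p : ℝ) ≠ 0 := by
    have : p ≠ 0 := by omega
    exact_mod_cast this
  split_ifs with h
  · subst h
    simp [expFun]
  · set w := expFun ((j : ℝ) - k) (1 / p) with hw
    have hr : ∀ r : ℕ, expFun ((j : ℝ) - k) (r / p) = w ^ r := fun r => by
      rw [hw, ← expFun_natCast_mul, mul_comm, expFun_mul_comm]; ring_nf
    have hwp : w ^ p = 1 := by
      rw [← hr, div_self hp0]
      exact (expFun_eq_one_iff _ _).2 ⟨j - k, by push_cast; ring⟩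
    have hw1 : w ≠ 1 := by
      intro hc
      obtain ⟨n, hn⟩ := (expFun_eq_one_iff _ _).1 hc
      field_simp at hn
      have hn' : (j : ℤ) - k = p * n := by exact_mod_cast hn
      have hd : (p : ℤ) ∣ (j : ℤ) - k := ⟨n, hn'⟩
      have := Int.eq_zero_of_abs_lt_dvd hd (by rw [abs_lt]; omega)
      omega
    simp_rw [hr]
    have := geom_sum_mul w p
    rw [hwp, sub_self] at this
    exact (mul_eq_zero.1 this).resolve_right (sub_ne_zero.2 hw1)

/-- Expanding the squares, orthogonality of the characters of ℤ/p kills the off-diagonal terms.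
These are the weights of the averaging argument. -/
theorem sum_enorm_dirichletMask_sq {p : ℕ} (hp : 0 < p) (x : ℝ) :
    ∑ r ∈ Finset.range p, ‖dirichletMask p (x + r / p)‖ₑ ^ 2 = 1 := by
  have hp0 : (p : ℂ) ≠ 0 := by exact_mod_cast hp.ne'
  have hc : ∑ r ∈ Finset.range p, ((‖dirichletMask p (x + r / p)‖ ^ 2 : ℝ) : ℂ) = 1 := by
    have h1 : ∀ r : ℕ, ((‖dirichletMask p (x + r / p)‖ ^ 2 : ℝ) : ℂ) =
        ((p : ℂ)⁻¹ * (p : ℂ)⁻¹) * ∑ j ∈ Finset.range p, ∑ k ∈ Finset.range p,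
          expFun ((j : ℝ) - k) x * expFun ((j : ℝ) - k) (r / p) := fun r => by
      rw [Complex.ofReal_pow, ← Complex.mul_conj', dirichletMask, map_mul, map_inv₀,
        Complex.conj_natCast, map_sum, mul_mul_mul_comm, Finset.sum_mul_sum]
      congr 1
      refine Finset.sum_congr rfl fun j _ => Finset.sum_congr rfl fun k _ => ?_
      rw [conj_expFun, ← expFun_add, ← expFun_add_right, sub_eq_add_neg]
    simp_rw [h1]
    rw [← Finset.mul_sum, Finset.sum_comm]
    have h2 : ∀ j ∈ Finset.range p, ∑ r ∈ Finset.range p, ∑ k ∈ Finset.range p,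
        expFun ((j : ℝ) - k) x * expFun ((j : ℝ) - k) (r / p) = p := fun j hj => by
      rw [Finset.sum_comm]
      simp_rw [← Finset.mul_sum]
      rw [Finset.sum_congr rfl fun k hk => by
        rw [sum_expFun_div (Finset.mem_range.1 hj) (Finset.mem_range.1 hk), mul_ite, mul_zero]]
      rw [Finset.sum_ite_eq, if_pos hj]
      simp [expFun]
    rw [Finset.sum_congr rfl h2]
    simp only [Finset.sum_const, Finset.card_range, nsmul_eq_mul]
    field_simp
  have hr : ∑ r ∈ Finset.range p, ‖dirichletMask p (x + r / p)‖ ^ 2 = 1 := by exact_mod_cast hc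
  simp_rw [enorm_sq_eq_ofReal]
  rw [← ENNReal.ofReal_sum_of_nonneg fun _ _ => by positivity, hr, ENNReal.ofReal_one]

/-! ### Averages against maxima over the cells of a class -/

section Selection

variable {α ι : Type*}

open Classical in
/-- The total weight of the elements of class `i` and digit `k`. -/
noncomputable def cellSum (cls : α → ι) (dig : α → ℕ) (W : α → ℝ≥0∞) (i : ι) (k : ℕ) : ℝ≥0∞ :=
  ∑' a, if cls a = i ∧ dig a = k then W a else 0

open Classical in
theorem tsum_selection (cls : α → ι) (dig : α → ℕ) (W : α → ℝ≥0∞) (σ : ι → ℕ) :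
    ∑' a, (if dig a = σ (cls a) then W a else 0) = ∑' i, cellSum cls dig W i (σ i) := by
  unfold cellSum
  rw [ENNReal.tsum_comm]
  refine tsum_congr fun a => ?_
  rw [tsum_eq_single (cls a) fun i hi => if_neg fun h => hi h.1.symm]
  simp

open Classical in
/-- If every selection of one digit in each class has weight at most one and an average with
positive coefficients over the digits has weight one, then the weight of a cell does not depend on
the digit. -/
theorem cellSum_eq {p : ℕ} {cls : α → ι} {dig : α → ℕ} {W : α → ℝ≥0∞} {P : ι → ℕ → ℝ≥0∞}
    (hdig : ∀ a, dig a < p) (hP : ∀ i, ∑ k ∈ Finset.range p, P i k = 1)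
    (hP0 : ∀ a, ∀ k < p, P (cls a) k ≠ 0) (hsum : ∑' a, P (cls a) (dig a) * W a = 1)
    (hle : ∀ σ : ι → ℕ, (∀ i, σ i < p) → ∑' a, (if dig a = σ (cls a) then W a else 0) ≤ 1) :
    (∀ i, ∀ k < p, ∀ k' < p, cellSum cls dig W i k = cellSum cls dig W i k') ∧
      ∀ σ : ι → ℕ, (∀ i, σ i < p) → ∑' a, (if dig a = σ (cls a) then W a else 0) = 1 := by
  set q := cellSum cls dig W with hq
  have hp : 0 < p := by
    by_contra h
    have : IsEmpty α := ⟨fun a => h ((Nat.zero_le _).trans_lt (hdig a))⟩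
    simp at hsum
  have hmax : ∀ i, ∃ m ∈ Finset.range p, ∀ k ∈ Finset.range p, q i k ≤ q i m := fun i =>
    Finset.exists_max_image _ _ ⟨0, Finset.mem_range.2 hp⟩
  -- `m i` is the digit of the heaviest cell in class `i`.
  choose m hm hmq using hmax
  have hB : ∑' i, q i (m i) ≤ 1 := by
    rw [hq, ← tsum_selection]
    exact hle m fun i => Finset.mem_range.1 (hm i)
  have hA : ∑' i, ∑ k ∈ Finset.range p, P i k * q i k = 1 := by
    rw [← hsum]
    simp_rw [hq, cellSum, ← ENNReal.tsum_mul_left]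
    have : ∀ i, ∑ k ∈ Finset.range p, ∑' a, P i k * (if cls a = i ∧ dig a = k then W a else 0) =
        ∑' a, ∑ k ∈ Finset.range p, P i k * (if cls a = i ∧ dig a = k then W a else 0) := fun i =>
      (Summable.tsum_finsetSum fun _ _ => ENNReal.summable).symm
    simp_rw [this]
    rw [ENNReal.tsum_comm]
    refine tsum_congr fun a => ?_
    rw [tsum_eq_single (cls a) fun i hi => Finset.sum_eq_zero fun k _ => by
      rw [if_neg fun h => hi h.1.symm, mul_zero]]
    rw [Finset.sum_eq_single (dig a) (fun k _ hk => by
      rw [if_neg fun h => hk h.2.symm, mul_zero])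
      fun h => absurd (Finset.mem_range.2 (hdig a)) h]
    simp
  have hAB : ∀ i, ∑ k ∈ Finset.range p, P i k * q i k ≤ q i (m i) := fun i => by
    calc ∑ k ∈ Finset.range p, P i k * q i k ≤ ∑ k ∈ Finset.range p, P i k * q i (m i) :=
          Finset.sum_le_sum fun k hk => mul_le_mul_right (hmq i k hk) _
      _ = q i (m i) := by rw [← Finset.sum_mul, hP, one_mul]
  -- A strict inequality in one class would make the total of the averages, which is 1, smaller than
  -- the total of the maxima, which is at most 1.
  have hEq : ∀ i, ∑ k ∈ Finset.range p, P i k * q i k = q i (m i) := fun i => by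
    by_contra hne
    have := ENNReal.tsum_lt_tsum (by rw [hA]; exact ENNReal.one_ne_top) hAB
      (lt_of_le_of_ne (hAB i) hne)
    rw [hA] at this
    exact absurd hB this.not_ge
  have hqm : ∀ i, ∀ k < p, q i k = q i (m i) := by
    intro i k hk
    -- Positivity of the coefficients is available only for classes that occur; in the others all
    -- cells have weight zero.
    by_cases hi : ∃ a, cls a = i
    · obtain ⟨a, rfl⟩ := hi
      have hfin : q (cls a) (m (cls a)) ≠ ∞ :=
        ((ENNReal.le_tsum _).trans_lt (hB.trans_lt ENNReal.one_lt_top)).ne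
      have hfinP : ∀ k ∈ Finset.range p, P (cls a) k ≠ ∞ := fun k hk =>
        ((Finset.single_le_sum (f := P (cls a)) (fun _ _ => zero_le) hk).trans_lt
          (by rw [hP]; exact ENNReal.one_lt_top)).ne
      by_contra hne
      have hlt : q (cls a) k < q (cls a) (m (cls a)) :=
        lt_of_le_of_ne (hmq _ k (Finset.mem_range.2 hk)) hne
      have h1 : ∑ k ∈ Finset.range p, P (cls a) k * q (cls a) k <
          ∑ k ∈ Finset.range p, P (cls a) k * q (cls a) (m (cls a)) := by
        rw [← Finset.add_sum_erase _ _ (Finset.mem_range.2 hk),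
          ← Finset.add_sum_erase _ _ (Finset.mem_range.2 hk)]
        refine ENNReal.add_lt_add_of_lt_of_le ?_
          (ENNReal.mul_lt_mul_right (hP0 a k hk) (hfinP k (Finset.mem_range.2 hk)) hlt)
          (Finset.sum_le_sum fun k hk => mul_le_mul_right (hmq _ k (Finset.mem_of_mem_erase hk)) _)
        rw [ENNReal.sum_ne_top]
        exact fun k hk => ENNReal.mul_ne_top (hfinP k (Finset.mem_of_mem_erase hk))
          ((hmq _ k (Finset.mem_of_mem_erase hk)).trans_lt hfin.lt_top).ne
      rw [hEq, ← Finset.sum_mul, hP, one_mul] at h1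
      exact lt_irrefl _ h1
    · have h0 : ∀ k, q i k = 0 := fun k => by
        rw [hq, cellSum, ENNReal.tsum_eq_zero]
        exact fun a => if_neg fun h => hi ⟨a, h.1⟩
      rw [h0, h0]
  refine ⟨fun i k hk k' hk' => (hqm i k hk).trans (hqm i k' hk').symm, fun σ hσ => ?_⟩
  rw [tsum_selection, ← hA]
  exact tsum_congr fun i => by rw [hEq, ← hqm i _ (hσ i)]

end Selection

/-! ### Classes and digits of frequencies -/

/-- The residue modulo `p` of the integral part of `p x`. -/
noncomputable def digit (p : ℕ) (x : ℝ) : ℕ := (⌊p * x⌋ % (p : ℤ)).toNat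

theorem digit_lt {p : ℕ} (hp : 0 < p) (x : ℝ) : digit p x < p := by
  have h1 := Int.emod_lt_of_pos ⌊p * x⌋ (by exact_mod_cast hp : (0 : ℤ) < p)
  have h2 := Int.emod_nonneg ⌊p * x⌋ (by exact_mod_cast hp.ne' : (p : ℤ) ≠ 0)
  rw [digit]; omega

theorem exists_eq_fract_add_digit {p : ℕ} (hp : 0 < p) (x : ℝ) :
    ∃ n : ℤ, x = Int.fract (p * x) / p + digit p x / p + n := by
  refine ⟨⌊p * x⌋ / (p : ℤ), ?_⟩
  have h2 := Int.emod_nonneg ⌊p * x⌋ (by exact_mod_cast hp.ne' : (p : ℤ) ≠ 0)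
  have hd : ((digit p x : ℕ) : ℤ) = ⌊p * x⌋ % (p : ℤ) := Int.toNat_of_nonneg h2
  have h3 := Int.emod_add_mul_ediv ⌊p * x⌋ (p : ℤ)
  rw [← hd] at h3
  have h4 : (digit p x : ℝ) + p * ((⌊p * x⌋ / (p : ℤ) : ℤ) : ℝ) = ⌊p * x⌋ := by exact_mod_cast h3
  have hp0 : (p : ℝ) ≠ 0 := by exact_mod_cast hp.ne'
  have h5 := Int.floor_add_fract (p * x)
  rw [← mul_right_inj' hp0, mul_add, mul_add, mul_div_cancel₀ _ hp0, mul_div_cancel₀ _ hp0]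
  linarith

/-- The frequencies in `Λ` that have the selected digit in their class modulo `(1 / p) ℤ`. -/
def selection (p : ℕ) (s : ℝ) (σ : ℝ → ℕ) (Λ : Set ℝ) : Set ℝ :=
  {l ∈ Λ | digit p (s * l) = σ (Int.fract (p * (s * l)))}

/-- The frequencies in `Λ` with class `i` modulo `(1 / p) ℤ` and digit `k`. -/
def cell (p : ℕ) (s : ℝ) (Λ : Set ℝ) (i : ℝ) (k : ℕ) : Set ℝ :=
  {l ∈ Λ | Int.fract (p * (s * l)) = i ∧ digit p (s * l) = k}

theorem energy_sep (φ : ℝ → ℂ) (T : Set ℝ) (Q : ℝ → Prop) [DecidablePred Q] (ξ : ℝ) :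
    energy φ {l ∈ T | Q l} ξ = ∑' l : T, if Q l then ‖φ (l - ξ)‖ₑ ^ 2 else 0 := by
  rw [energy, tsum_subtype {l ∈ T | Q l} fun l => ‖φ (l - ξ)‖ₑ ^ 2,
    tsum_subtype T fun l => if Q l then ‖φ (l - ξ)‖ₑ ^ 2 else 0]
  refine tsum_congr fun l => ?_
  by_cases h1 : l ∈ T <;> by_cases h2 : Q l <;> simp [Set.indicator, h1, h2]

/-- The mask cannot vanish at a difference of two selected frequencies: in different classes the
scaled difference is outside (1/p)ℤ, and in one class the digits agree, so it is an integer. -/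
theorem IsOrthogonalSet.selection {φ ψ : ℝ → ℂ} {p : ℕ} (hp : 0 < p) {s : ℝ}
    (hφ : ∀ ξ, φ ξ = dirichletMask p (s * ξ) * ψ ξ) {Λ : Set ℝ} (h : IsOrthogonalSet φ Λ)
    (σ : ℝ → ℕ) : IsOrthogonalSet ψ (selection p s σ Λ) := by
  rintro l ⟨hl, hls⟩ l' ⟨hl', hls'⟩ hne
  have h0 := h l hl l' hl' hne
  rw [hφ] at h0
  refine (mul_eq_zero.1 h0).resolve_left fun hz => ?_
  obtain ⟨⟨n, hn⟩, hno⟩ := dirichletMask_eq_zero hp hz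
  have hf : Int.fract (p * (s * l)) = Int.fract (p * (s * l')) :=
    Int.fract_eq_fract.2 ⟨n, by rw [← hn]; ring⟩
  obtain ⟨a, ha⟩ := exists_eq_fract_add_digit hp (s * l)
  obtain ⟨c, hc⟩ := exists_eq_fract_add_digit hp (s * l')
  rw [hls, hf, ← hls'] at ha
  refine hno (a - c) ?_
  rw [mul_sub]
  push_cast
  linarith

/-- Passing from `φ` to its factor `ψ`: at a generic point the energy of a cell does not depend on
its digit, and every selection has energy one. -/
theorem energy_selection {φ ψ : ℝ → ℂ} {p : ℕ} (hp : 0 < p) {s : ℝ}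
    (hφ : ∀ ξ, φ ξ = dirichletMask p (s * ξ) * ψ ξ) {Λ : Set ℝ} {ξ : ℝ}
    (hle : ∀ σ : ℝ → ℕ, energy ψ (selection p s σ Λ) ξ ≤ 1) (he : energy φ Λ ξ = 1)
    (hξ : ∀ l ∈ Λ, ∀ n : ℤ, p * (s * (l - ξ)) ≠ n) :
    (∀ i, ∀ k < p, ∀ k' < p, energy ψ (cell p s Λ i k) ξ = energy ψ (cell p s Λ i k') ξ) ∧
      ∀ σ : ℝ → ℕ, (∀ i, σ i < p) → energy ψ (selection p s σ Λ) ξ = 1 := by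
  classical
  have hp0 : (p : ℝ) ≠ 0 := by exact_mod_cast hp.ne'
  have key := cellSum_eq (p := p) (cls := fun l : Λ => Int.fract (p * (s * (l : ℝ))))
    (dig := fun l : Λ => digit p (s * (l : ℝ))) (W := fun l : Λ => ‖ψ (l - ξ)‖ₑ ^ 2)
    -- By periodicity the mask at s(l - ξ) depends only on the class and digit of `l`.
    (P := fun i k => ‖dirichletMask p ((i / p - s * ξ) + k / p)‖ₑ ^ 2)
    (fun l => digit_lt hp _) (fun i => sum_enorm_dirichletMask_sq hp _) ?_ ?_ ?_
  · refine ⟨fun i k hk k' hk' => ?_, fun σ hσ => ?_⟩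
    · rw [cell, cell, energy_sep, energy_sep]
      convert key.1 i k hk k' hk' using 1 <;> rw [cellSum]
    · rw [selection, energy_sep]
      exact key.2 σ hσ
  · rintro ⟨l, hl⟩ k hk h0
    have h1 : dirichletMask p ((Int.fract (p * (s * l)) / p - s * ξ) + k / p) = 0 := by
      simpa using h0
    obtain ⟨n, hn⟩ := (dirichletMask_eq_zero hp h1).1
    refine hξ l hl (n - k + ⌊p * (s * l)⌋) ?_
    have h5 := Int.floor_add_fract (p * (s * l))
    push_cast
    rw [← hn]
    field_simp
    field_simp at h5
    linarith
  · rw [← he, energy]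
    refine tsum_congr fun l => ?_
    rw [hφ, enorm_mul, mul_pow]
    congr 3
    obtain ⟨n, hn⟩ := exists_eq_fract_add_digit hp (s * (l : ℝ))
    rw [← dirichletMask_add_int p _ n]
    congr 1
    rw [mul_sub]
    linarith
  · intro σ hσ
    have := hle σ
    rwa [selection, energy_sep] at this

theorem energy_mono (φ : ℝ → ℂ) {S T : Set ℝ} (h : S ⊆ T) (ξ : ℝ) : energy φ S ξ ≤ energy φ T ξ :=
  ENNReal.tsum_mono_subtype (fun l => ‖φ (l - ξ)‖ₑ ^ 2) h

theorem energy_insert (φ : ℝ → ℂ) {T : Set ℝ} {a : ℝ} (h : a ∉ T) (ξ : ℝ) :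
    energy φ (insert a T) ξ = ‖φ (a - ξ)‖ₑ ^ 2 + energy φ T ξ := by
  have := ENNReal.summable.tsum_union_disjoint (f := fun l => ‖φ (l - ξ)‖ₑ ^ 2)
    (Set.disjoint_singleton_left.2 h) ENNReal.summable
  rw [Set.singleton_union] at this
  rw [energy, this, tsum_singleton a fun l => ‖φ (l - ξ)‖ₑ ^ 2, energy]

theorem energy_image (φ ψ : ℝ → ℂ) (g : ℝ → ℝ) (hg : g.Injective) (T : Set ℝ) {ξ ξ' : ℝ}
    (h : ∀ l ∈ T, φ (g l - ξ) = ψ (l - ξ')) : energy φ (g '' T) ξ = energy ψ T ξ' := by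
  rw [energy, tsum_image (fun l => ‖φ (l - ξ)‖ₑ ^ 2) hg.injOn]
  exact tsum_congr fun l => by rw [h l l.2]

theorem countable_resonant {Λ : Set ℝ} (hΛ : Λ.Countable) (p : ℕ) {s : ℝ} (hp : 0 < p)
    (hs : s ≠ 0) : {ξ : ℝ | ∃ l ∈ Λ, ∃ n : ℤ, p * (s * (l - ξ)) = n}.Countable := by
  have hp0 : (p : ℝ) ≠ 0 := by exact_mod_cast hp.ne'
  refine ((hΛ.prod (Set.countable_univ (α := ℤ))).image
    fun q : ℝ × ℤ => q.1 - q.2 / (p * s)).mono ?_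
  rintro ξ ⟨l, hl, n, hn⟩
  refine ⟨(l, n), ⟨hl, trivial⟩, ?_⟩
  simp only [← hn]
  field_simp
  ring

theorem mem_cell_zero_iff {p : ℕ} (hp : 0 < p) {s : ℝ} {Λ : Set ℝ} {k : ℕ} {l : ℝ}
    (h : l ∈ cell p s Λ 0 k) : l ∈ Λ ∧ ∃ n : ℤ, s * l = k / p + n := by
  obtain ⟨n, hn⟩ := exists_eq_fract_add_digit hp (s * l)
  rw [h.2.1, h.2.2, zero_div, zero_add] at hn
  exact ⟨h.1, n, hn⟩

theorem zero_mem_cell {p : ℕ} {s : ℝ} {Λ : Set ℝ} (h : (0 : ℝ) ∈ Λ) : (0 : ℝ) ∈ cell p s Λ 0 0 := by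
  refine ⟨h, ?_, ?_⟩ <;> simp [digit]

/-! ### Two successive masks -/

/-- If `φ` has two successive mask factors and a complete set of frequencies through `0`, then
the frequency lattices of the two masks are not in general position. -/
theorem exists_lattice_relation {φ ψ χ : ℝ → ℂ} {p q : ℕ} (hp : 2 ≤ p) (hq : 2 ≤ q) {s r : ℝ}
    (hs : s ≠ 0) (hr : r ≠ 0)
    (hφ : ∀ ξ, φ ξ = dirichletMask p (s * ξ) * ψ ξ) (hψ : ∀ ξ, ψ ξ = dirichletMask q (r * ξ) * χ ξ)
    (hψB : ∀ T, IsOrthogonalSet ψ T → ∀ ξ, energy ψ T ξ ≤ 1)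
    (hχB : ∀ T, IsOrthogonalSet χ T → ∀ ξ, energy χ T ξ ≤ 1)
    (hχc : Continuous χ) (hχ0 : χ 0 ≠ 0) {Λ : Set ℝ} (hΛ : Λ.Countable) (h0 : (0 : ℝ) ∈ Λ)
    (ho : IsOrthogonalSet φ Λ) (he : ∀ ξ, energy φ Λ ξ = 1) :
    (∃ x, ∃ m n : ℤ, s * x = m ∧ r * x = 1 / q + n) ∨
      ∃ x, ∃ m n : ℤ, s * x = 1 / p + m ∧ r * x = n := by
  by_contra! hcon
  obtain ⟨h1, h2⟩ := hcon
  have hp' : 0 < p := by omega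
  have hq' : 0 < q := by omega
  -- The resonant points are countable, so some nonresonant ξ lies in the nonempty open set where
  -- χ(-ξ) ≠ 0.
  obtain ⟨ξ, hξχ, hξ⟩ : ∃ ξ, χ (0 - ξ) ≠ 0 ∧ (∀ l ∈ Λ, ∀ n : ℤ, p * (s * (l - ξ)) ≠ n) ∧
      ∀ l ∈ Λ, ∀ n : ℤ, q * (r * (l - ξ)) ≠ n := by
    have hd := ((countable_resonant hΛ p hp' hs).union
      (countable_resonant hΛ q hq' hr)).dense_compl ℝ
    obtain ⟨ξ, hξ1, hξ2⟩ := hd.inter_open_nonempty {ξ | χ (0 - ξ) ≠ 0}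
      (isOpen_ne_fun (hχc.comp (continuous_const.sub continuous_id)) continuous_const)
      ⟨0, by simpa using hχ0⟩
    refine ⟨ξ, hξ1, fun l hl n hn => hξ2 (Or.inl ⟨l, hl, n, hn⟩),
      fun l hl n hn => hξ2 (Or.inr ⟨l, hl, n, hn⟩)⟩
  have main : ∀ σ : ℝ → ℕ, (∀ i, σ i < p) → energy χ (cell q r (selection p s σ Λ) 0 0) ξ =
      energy χ (cell q r (selection p s σ Λ) 0 1) ξ := by
    intro σ hσ
    have hS := (energy_selection hp' hφ (fun σ => hψB _ (ho.selection hp' hφ σ) ξ) (he ξ)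
      hξ.1).2 σ hσ
    exact (energy_selection hq' hψ
      (fun τ => hχB _ ((ho.selection hp' hφ σ).selection hq' hψ τ) ξ) hS
      fun l hl => hξ.2 l hl.1).1 0 0 (by omega) 1 (by omega)
  -- In class 0, σ keeps the `l` with s·l ∈ ℤ and σ' those with s·l ∈ 1/p + ℤ. In every other class
  -- they agree, and `R` is this common part.
  set σ : ℝ → ℕ := fun _ => 0
  set σ' : ℝ → ℕ := fun i => if i = 0 then 1 else 0
  set R : Set ℝ := {l ∈ selection p s σ Λ | Int.fract (p * (s * l)) ≠ 0} with hR
  have hcell : ∀ {τ : ℝ → ℕ} {l : ℝ}, l ∈ selection p s τ Λ → Int.fract (p * (s * l)) = 0 →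
      ∃ n : ℤ, s * l = (τ 0 : ℕ) / p + n := fun {τ l} hl hf =>
    (mem_cell_zero_iff (Λ := Λ) hp' ⟨hl.1, hf, by rw [hl.2, hf]⟩).2
  have hR' : ∀ l, l ∈ R ↔ l ∈ selection p s σ' Λ ∧ Int.fract (p * (s * l)) ≠ 0 := by
    intro l
    simp only [hR, selection, Set.mem_ofPred_eq, and_congr_left_iff, and_congr_right_iff]
    intro hf _
    simp [σ, σ', hf]
  -- A frequency outside `R` here would have s·l ∈ ℤ and r·l ∈ 1/q + ℤ, against `h1`.
  have e1 : energy χ (cell q r (selection p s σ Λ) 0 1) ξ ≤ energy χ (cell q r R 0 1) ξ := by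
    refine energy_mono _ ?_ _
    intro l hl
    refine ⟨⟨hl.1, fun hf => ?_⟩, hl.2⟩
    obtain ⟨n, hn⟩ := hcell hl.1 hf
    obtain ⟨m, hm⟩ := (mem_cell_zero_iff hq' hl).2
    exact h1 l n m (by simpa [σ] using hn) (by simpa using hm)
  -- The frequency 0 lies in the cell of digit 0 but not in `R`.
  have e2 : ‖χ (0 - ξ)‖ₑ ^ 2 + energy χ (cell q r R 0 0) ξ ≤
      energy χ (cell q r (selection p s σ Λ) 0 0) ξ := by
    rw [← energy_insert]
    · refine energy_mono _ (Set.insert_subset (zero_mem_cell ?_) fun l hl => ⟨hl.1.1, hl.2⟩) _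
      exact ⟨h0, by simp [digit, σ]⟩
    · exact fun h => h.1.2 (by simp)
  have e3 : energy χ (cell q r (selection p s σ' Λ) 0 0) ξ ≤ energy χ (cell q r R 0 0) ξ := by
    refine energy_mono _ ?_ _
    intro l hl
    refine ⟨(hR' l).2 ⟨hl.1, fun hf => ?_⟩, hl.2⟩
    obtain ⟨n, hn⟩ := hcell hl.1 hf
    obtain ⟨m, hm⟩ := (mem_cell_zero_iff hq' hl).2
    exact h2 l n m (by simpa [σ'] using hn) (by simpa using hm)
  have e4 : energy χ (cell q r R 0 1) ξ ≤ energy χ (cell q r (selection p s σ' Λ) 0 1) ξ := by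
    refine energy_mono _ ?_ _
    exact fun l hl => ⟨((hR' l).1 hl.1).1, hl.2⟩
  have m1 := main σ fun _ => hp'
  have m2 := main σ' fun i => by simp only [σ']; split_ifs <;> omega
  have hfin : energy χ (cell q r R 0 1) ξ ≠ ∞ := by
    refine ((hχB _ (fun l hl l' hl' hne => ?_) ξ).trans_lt ENNReal.one_lt_top).ne
    refine ((ho.selection hp' hφ σ).selection hq' hψ fun _ => 1) l
      ⟨hl.1.1, hl.2.2⟩ l' ⟨hl'.1.1, hl'.2.2⟩ hne
  have hfin0 : energy χ (cell q r R 0 0) ξ ≠ ∞ := by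
    have : energy χ (cell q r R 0 0) ξ ≤ energy χ (cell q r R 0 1) ξ :=
      le_add_self.trans (e2.trans (m1.le.trans e1))
    exact (this.trans_lt hfin.lt_top).ne
  -- With E₀, E₁ the energies of the digit-0 and digit-1 cells of `R`: |χ(-ξ)|² + E₀ ≤ E₁ from σ,
  -- and E₁ ≤ E₀ from σ'.
  have hle : ‖χ (0 - ξ)‖ₑ ^ 2 + energy χ (cell q r R 0 1) ξ ≤ 0 + energy χ (cell q r R 0 1) ξ := by
    rw [zero_add]
    calc _ ≤ ‖χ (0 - ξ)‖ₑ ^ 2 + energy χ (cell q r R 0 0) ξ :=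
          add_le_add_right (e4.trans (m2.symm.le.trans e3)) _
      _ ≤ _ := e2.trans (m1.le.trans e1)
  have hz := ENNReal.le_of_add_le_add_right hfin hle
  exact hξχ (by simpa using hz)

/-! ### Shifted spectra and factors of a spectral measure -/

/-- A spectrum can be shifted so that it contains `0`. -/
theorem exists_shift_zero_mem {φ : ℝ → ℂ} {Λ : Set ℝ} (hΛ : Λ.Countable)
    (ho : IsOrthogonalSet φ Λ) (he : ∀ ξ, energy φ Λ ξ = 1) :
    ∃ Λ' : Set ℝ, Λ'.Countable ∧ (0 : ℝ) ∈ Λ' ∧ IsOrthogonalSet φ Λ' ∧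
      ∀ ξ, energy φ Λ' ξ = 1 := by
  obtain ⟨a, ha⟩ : Λ.Nonempty := by
    by_contra h
    rw [Set.not_nonempty_iff_eq_empty] at h
    have := he 0
    simp [energy, h] at this
  refine ⟨(fun l => l - a) '' Λ, hΛ.image _, ⟨a, ha, sub_self a⟩, ?_, fun ξ => ?_⟩
  · rintro _ ⟨l, hl, rfl⟩ _ ⟨l', hl', rfl⟩ hne
    simp only [sub_sub_sub_cancel_right]
    exact ho l hl l' hl' fun e => hne (by rw [e])
  · rw [energy_image φ φ _ (sub_left_injective) Λ (ξ' := ξ + a), he]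
    intro l _
    ring_nf

theorem fourierTransform_map_mul (μ : Measure ℝ) (a l : ℝ) :
    fourierTransform (μ.map (a * ·)) l = fourierTransform μ (a * l) := by
  rw [fourierTransform_eq_charFun, fourierTransform_eq_charFun, charFun_map_mul]
  ring_nf

/-- If `μ` is the convolution of a scaled uniform measure on `{0, …, p - 1}` with a scaled copy of
`ν`, and `μ` has a spectrum, then so does `ν`. -/
theorem exists_isSpectrum_of_factor {μ ν : Measure ℝ} [IsProbabilityMeasure μ]
    [IsProbabilityMeasure ν] {p : ℕ} (hp : 0 < p) {s a : ℝ} (hs : s ≠ 0) (ha : a ≠ 0)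
    (h : ∀ ξ, fourierTransform μ ξ = dirichletMask p (s * ξ) * fourierTransform ν (a * ξ))
    {Λ : Set ℝ} (hΛ : IsSpectrum μ Λ) : ∃ Λ', IsSpectrum ν Λ' := by
  have hν : IsProbabilityMeasure (ν.map (a * ·)) :=
    Measure.isProbabilityMeasure_map (measurable_const_mul a).aemeasurable
  have h' : ∀ ξ, fourierTransform μ ξ =
      dirichletMask p (s * ξ) * fourierTransform (ν.map (a * ·)) ξ := fun ξ => by
    rw [h, fourierTransform_map_mul]
  have ho := hΛ.isOrthogonalSet.selection hp h' fun _ => 0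
  set S := selection p s (fun _ => 0) Λ
  have hSΛ : S ⊆ Λ := fun l hl => hl.1
  refine ⟨(a * ·) '' S, isSpectrum_of_energy ((hΛ.countable.mono hSΛ).image _)
    ((hΛ.discrete.mono hSΛ).image (Homeomorph.mulLeft₀ a ha).isInducing) ?_
    (S := (a * ·) '' {ξ : ℝ | ∃ l ∈ Λ, ∃ n : ℤ, p * (s * (l - ξ)) = n}ᶜ) ?_ ?_⟩
  · rintro _ ⟨l, hl, rfl⟩ _ ⟨l', hl', rfl⟩ hne
    simp only
    rw [← mul_sub, ← fourierTransform_map_mul]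
    exact ho l hl l' hl' fun e => hne (by rw [e])
  · exact ((Homeomorph.mulLeft₀ a ha).surjective.denseRange).dense_image
      (Homeomorph.mulLeft₀ a ha).continuous
      ((countable_resonant hΛ.countable p hp hs).dense_compl ℝ)
  · rintro _ ⟨ξ, hξ, rfl⟩
    rw [energy_image _ (fourierTransform (ν.map (a * ·))) _ (mul_right_injective₀ ha) S (ξ' := ξ)]
    · exact (energy_selection hp h'
        (fun σ => (hΛ.isOrthogonalSet.selection hp h' σ).energy_le_one ξ) (hΛ.energy_eq_one ξ)
        fun l hl n hn => hξ ⟨l, hl, n, hn⟩).2 _ fun _ => hp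
    · intro l _
      rw [fourierTransform_map_mul]
      ring_nf

/-! ### Transforms and supports of infinite convolutions -/

theorem isProbabilityMeasure_partialConvolution {ρ : ℕ → Measure ℝ}
    (hρ : ∀ k, IsProbabilityMeasure (ρ k)) (n : ℕ) :
    IsProbabilityMeasure (partialConvolution ρ n) := by
  induction n with
  | zero => rw [partialConvolution]; infer_instance
  | succ n ih => rw [partialConvolution]; infer_instance

theorem fourierTransform_partialConvolution {ρ : ℕ → Measure ℝ}
    (hρ : ∀ k, IsProbabilityMeasure (ρ k)) (n : ℕ) (l : ℝ) :
    fourierTransform (partialConvolution ρ n) l =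
      ∏ k ∈ Finset.range n, fourierTransform (ρ k) l := by
  induction n with
  | zero => simp [partialConvolution, fourierTransform, expFun]
  | succ n ih =>
    have := isProbabilityMeasure_partialConvolution hρ n
    rw [Finset.prod_range_succ, ← ih, partialConvolution, fourierTransform_eq_charFun, charFun_conv,
      ← fourierTransform_eq_charFun, ← fourierTransform_eq_charFun]

theorem ConvergesWeakly.tendsto_fourierTransform {m : ℕ → Measure ℝ} {μ : Measure ℝ}
    [∀ k, IsFiniteMeasure (m k)] [IsFiniteMeasure μ] (h : ConvergesWeakly m μ) (l : ℝ) :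
    Tendsto (fun k => fourierTransform (m k) l) atTop (𝓝 (fourierTransform μ l)) := by
  let fr : ℝ →ᵇ ℝ := BoundedContinuousFunction.ofNormedAddCommGroup (fun x => (expFun l x).re)
    (Complex.continuous_re.comp (continuous_expFun l)) 1
    fun x => (Complex.abs_re_le_norm _).trans (norm_expFun l x).le
  let fi : ℝ →ᵇ ℝ := BoundedContinuousFunction.ofNormedAddCommGroup (fun x => (expFun l x).im)
    (Complex.continuous_im.comp (continuous_expFun l)) 1
    fun x => (Complex.abs_im_le_norm _).trans (norm_expFun l x).le
  have key : ∀ (ν : Measure ℝ) [IsFiniteMeasure ν], fourierTransform ν l =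
      ((∫ x, fr x ∂ν : ℝ) : ℂ) + ((∫ x, fi x ∂ν : ℝ) : ℂ) * Complex.I := fun ν _ =>
    (integral_re_add_im (𝕜 := ℂ) (integrable_expFun ν l)).symm
  rw [key μ]
  simp_rw [fun k => key (m k)]
  exact ((Complex.continuous_ofReal.tendsto _).comp (h fr)).add
    (((Complex.continuous_ofReal.tendsto _).comp (h fi)).mul_const _)

theorem fourierTransform_uniformMeasure_image {p : ℕ} {c : ℝ} (hc : c ≠ 0) (l : ℝ) :
    fourierTransform (uniformMeasure ((Finset.range p).image fun j : ℕ => c * (j : ℝ))) l =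
      dirichletMask p (c * l) := by
  have hinj : Function.Injective fun j : ℕ => c * (j : ℝ) := fun i j h => by
    simpa [hc] using h
  rw [fourierTransform, uniformMeasure, integral_smul_measure, integral_finsetSum_measure,
    Finset.card_image_of_injective _ hinj, Finset.card_range, dirichletMask,
    Finset.sum_image fun i _ j _ h => hinj h]
  · simp only [integral_dirac, ENNReal.toReal_inv, ENNReal.toReal_natCast, Complex.real_smul,
      Complex.ofReal_inv, Complex.ofReal_natCast]
    congr 1
    refine Finset.sum_congr rfl fun j _ => ?_
    rw [← expFun_mul_comm, expFun, expFun]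
    push_cast; ring_nf
  · exact fun i _ => integrable_expFun _ _

theorem scaledDigits_consecutiveDigits (b : ℕ → ℤ) (p : ℕ → ℕ) (t : ℕ → ℤ) (k : ℕ) :
    scaledDigits b (fun n => consecutiveDigits (p n) (t n)) k =
      (Finset.range (p k)).image fun j : ℕ =>
        ((∏ i ∈ Finset.range (k + 1), (b i : ℝ))⁻¹ * t k) * (j : ℝ) := by
  rw [scaledDigits, consecutiveDigits, Finset.image_image]
  refine Finset.image_congr fun j _ => ?_
  simp only [Function.comp]
  push_cast; ring

/-- The test function min(1, max(0, |x| - R)) vanishes exactly on [-R, R]. -/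
theorem ConvergesWeakly.ae_abs_le {m : ℕ → Measure ℝ} {μ : Measure ℝ} [IsFiniteMeasure μ]
    (h : ConvergesWeakly m μ) {R : ℝ} (hm : ∀ k, ∀ᵐ x ∂(m k), |x| ≤ R) : ∀ᵐ x ∂μ, |x| ≤ R := by
  have hnn : ∀ x : ℝ, 0 ≤ min 1 (max 0 (|x| - R)) := fun x =>
    le_min zero_le_one (le_max_left _ _)
  let f : ℝ →ᵇ ℝ := BoundedContinuousFunction.ofNormedAddCommGroup
    (fun x => min 1 (max 0 (|x| - R))) (by fun_prop) 1 fun x => by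
      rw [Real.norm_of_nonneg (hnn x)]
      exact min_le_left _ _
  have h0 : ∀ k, ∫ x, f x ∂(m k) = 0 := fun k => by
    refine integral_eq_zero_of_ae ?_
    filter_upwards [hm k] with x hx
    change min 1 (max 0 (|x| - R)) = 0
    rw [max_eq_left (by linarith), min_eq_right zero_le_one]
  have h1 := h f
  simp_rw [h0] at h1
  have h2 : ∫ x, f x ∂μ = 0 := tendsto_nhds_unique h1 tendsto_const_nhds
  rw [integral_eq_zero_iff_of_nonneg (show 0 ≤ ⇑f from hnn) (f.integrable μ)] at h2
  filter_upwards [h2] with x hx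
  by_contra! hlt
  have : 0 < min 1 (max 0 (|x| - R)) := lt_min one_pos (lt_max_of_lt_right (by linarith))
  exact this.ne' hx

theorem ae_abs_le_partialConvolution {ρ : ℕ → Measure ℝ} (hρ : ∀ k, IsProbabilityMeasure (ρ k))
    {C : ℕ → ℝ} (hb : ∀ k, ∀ᵐ x ∂(ρ k), |x| ≤ C k) (n : ℕ) :
    ∀ᵐ x ∂(partialConvolution ρ n), |x| ≤ ∑ k ∈ Finset.range n, C k := by
  have hS : Measurable fun ω : ℕ → ℝ => ∑ k ∈ Finset.range n, ω k :=
    Finset.measurable_fun_sum _ fun k _ => measurable_pi_apply k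
  rw [← map_sum_infinitePi ρ hρ n,
    ae_map_iff hS.aemeasurable (measurableSet_le measurable_abs measurable_const)]
  have hae : ∀ᵐ ω ∂(Measure.infinitePi ρ), ∀ k, |ω k| ≤ C k := by
    rw [ae_all_iff]
    exact fun k => (measurePreserving_eval_infinitePi ρ k).quasiMeasurePreserving.ae (hb k)
  filter_upwards [hae] with ω hω
  exact (Finset.abs_sum_le_sum_abs _ _).trans (Finset.sum_le_sum fun k _ => hω k)

/-! ### Moran measures with consecutive digits -/

/-- The parameters of a Moran measure with consecutive digits: integers `|b k| ≥ 2`, `p k ≥ 2` and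
`t k ≠ 0` with `p k * t k` bounded by `M`. -/
structure MoranData (b : ℕ → ℤ) (p : ℕ → ℕ) (t : ℕ → ℤ) (M : ℤ) : Prop where
  two_le_abs_base : ∀ k, 2 ≤ |b k|
  two_le_card : ∀ k, 2 ≤ p k
  one_le_abs_step : ∀ k, 1 ≤ |t k|
  abs_le : ∀ k, |(p k : ℤ) * t k| ≤ M

namespace MoranData

variable {b : ℕ → ℤ} {p : ℕ → ℕ} {t : ℕ → ℤ} {M : ℤ}

theorem base_ne_zero (h : MoranData b p t M) (k : ℕ) : (b k : ℝ) ≠ 0 := by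
  have := h.two_le_abs_base k
  have : b k ≠ 0 := by rintro h0; simp [h0] at this
  exact_mod_cast this

theorem step_ne_zero (h : MoranData b p t M) (k : ℕ) : (t k : ℝ) ≠ 0 := by
  have := h.one_le_abs_step k
  have : t k ≠ 0 := by rintro h0; simp [h0] at this
  exact_mod_cast this

theorem shift (h : MoranData b p t M) (k : ℕ) :
    MoranData (fun n => b (k + n)) (fun n => p (k + n)) (fun n => t (k + n)) M :=
  ⟨fun _ => h.1 _, fun _ => h.2 _, fun _ => h.3 _, fun _ => h.4 _⟩

theorem digits_nonempty (h : MoranData b p t M) (k : ℕ) :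
    (consecutiveDigits (p k) (t k)).Nonempty :=
  (Finset.nonempty_range_iff.2 (by have := h.two_le_card k; omega)).image _

theorem abs_digit_le (h : MoranData b p t M) (k : ℕ) :
    ∀ d ∈ consecutiveDigits (p k) (t k), |d| ≤ M := by
  intro d hd
  obtain ⟨j, hj, rfl⟩ := Finset.mem_image.1 hd
  refine le_trans ?_ (h.abs_le k)
  rw [abs_mul, abs_mul]
  refine mul_le_mul_of_nonneg_right ?_ (abs_nonneg _)
  have := Finset.mem_range.1 hj
  simp only [Nat.abs_cast]
  omega

theorem spec (h : MoranData b p t M) :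
    IsProbabilityMeasure (moranMeasure b fun k => consecutiveDigits (p k) (t k)) ∧
      ConvergesWeakly (partialConvolution fun k => uniformMeasure
        (scaledDigits b (fun k => consecutiveDigits (p k) (t k)) k))
        (moranMeasure b fun k => consecutiveDigits (p k) (t k)) :=
  moranMeasure_spec b _ h.two_le_abs_base h.digits_nonempty M h.abs_digit_le

theorem isProbabilityMeasure_factor (h : MoranData b p t M) (k : ℕ) : IsProbabilityMeasure
    (uniformMeasure (scaledDigits b (fun k => consecutiveDigits (p k) (t k)) k)) :=
  isProbabilityMeasure_uniformMeasure ((h.digits_nonempty k).image _)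

theorem tendsto_prod (h : MoranData b p t M) (l : ℝ) :
    Tendsto (fun n => ∏ k ∈ Finset.range n,
      dirichletMask (p k) ((∏ i ∈ Finset.range (k + 1), (b i : ℝ))⁻¹ * t k * l)) atTop
      (𝓝 (fourierTransform (moranMeasure b fun k => consecutiveDigits (p k) (t k)) l)) := by
  have := h.spec.1
  have := isProbabilityMeasure_partialConvolution h.isProbabilityMeasure_factor
  have hw := h.spec.2.tendsto_fourierTransform l
  refine hw.congr fun n => ?_
  rw [fourierTransform_partialConvolution h.isProbabilityMeasure_factor]
  refine Finset.prod_congr rfl fun k _ => ?_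
  rw [scaledDigits_consecutiveDigits, fourierTransform_uniformMeasure_image]
  exact mul_ne_zero (inv_ne_zero (Finset.prod_ne_zero_iff.2 fun i _ => h.base_ne_zero i))
    (h.step_ne_zero k)

/-- Splitting the index-0 factor off the infinite product leaves the product of the shifted
sequences at l / b 0. -/
theorem fourierTransform_eq (h : MoranData b p t M) (l : ℝ) :
    fourierTransform (moranMeasure b fun k => consecutiveDigits (p k) (t k)) l =
      dirichletMask (p 0) (t 0 / b 0 * l) *
        fourierTransform (moranTail b (fun k => consecutiveDigits (p k) (t k)) 1)
          ((b 0 : ℝ)⁻¹ * l) := by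
  have h1 := (tendsto_add_atTop_iff_nat 1).2 (h.tendsto_prod l)
  have h2 := ((h.shift 1).tendsto_prod ((b 0 : ℝ)⁻¹ * l)).const_mul
    (dirichletMask (p 0) (t 0 / b 0 * l))
  refine tendsto_nhds_unique h1 (h2.congr fun n => ?_)
  rw [Finset.prod_range_succ', mul_comm]
  congr 1
  · refine Finset.prod_congr rfl fun k _ => ?_
    rw [Finset.prod_range_succ' _ (k + 1), mul_inv]
    simp_rw [add_comm 1]
    congr 1
    ring
  · simp [div_eq_inv_mul]

theorem abs_scaledDigits_le (h : MoranData b p t M) (k : ℕ) {x : ℝ}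
    (hx : x ∈ scaledDigits b (fun k => consecutiveDigits (p k) (t k)) k) :
    |x| ≤ (1 / 2 : ℝ) ^ (k + 1) * M := by
  obtain ⟨d, hd, rfl⟩ := Finset.mem_image.1 hx
  have hd' : |(d : ℝ)| ≤ M := by exact_mod_cast h.abs_digit_le k d hd
  have hprod : (2 : ℝ) ^ (k + 1) ≤ ∏ i ∈ Finset.range (k + 1), |(b i : ℝ)| := by
    rw [← Finset.card_range (k + 1), ← Finset.prod_const, Finset.card_range]
    exact Finset.prod_le_prod (fun _ _ => by norm_num) fun i _ => by
      exact_mod_cast h.two_le_abs_base i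
  rw [abs_mul, abs_inv, Finset.abs_prod]
  refine mul_le_mul ?_ hd' (abs_nonneg _) (by positivity)
  rw [one_div, inv_pow]
  exact inv_anti₀ (by positivity) hprod

theorem ae_abs_le (h : MoranData b p t M) :
    ∀ᵐ x : ℝ ∂(moranMeasure b fun k => consecutiveDigits (p k) (t k)), |x| ≤ (M : ℝ) := by
  have := h.spec.1
  have hM : (0 : ℝ) ≤ M := by exact_mod_cast (abs_nonneg _).trans (h.abs_le 0)
  refine h.spec.2.ae_abs_le fun n => ?_
  have hfac : ∀ k, ∀ᵐ x ∂(uniformMeasure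
      (scaledDigits b (fun k => consecutiveDigits (p k) (t k)) k)),
      |x| ≤ (1 / 2 : ℝ) ^ (k + 1) * (M : ℝ) := fun k => by
    filter_upwards [ae_mem_uniformMeasure (scaledDigits b _ k)] with x hx
    exact h.abs_scaledDigits_le k hx
  filter_upwards [ae_abs_le_partialConvolution h.isProbabilityMeasure_factor hfac n] with x hx
  refine hx.trans ?_
  rw [← Finset.sum_mul]
  refine mul_le_of_le_one_left hM ?_
  have hsum : HasSum (fun k : ℕ => (1 / 2 : ℝ) ^ (k + 1)) 1 := by
    simpa [pow_succ] using hasSum_geometric_two.mul_right (1 / 2 : ℝ)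
  exact sum_le_hasSum _ (fun _ _ => by positivity) hsum

theorem isCompact_support (h : MoranData b p t M) :
    IsCompact (moranMeasure b fun k => consecutiveDigits (p k) (t k)).support := by
  refine (isCompact_Icc (a := -(M : ℝ)) (b := M)).of_isClosed_subset Measure.isClosed_support
    (Measure.support_subset_of_isClosed isClosed_Icc ?_)
  filter_upwards [h.ae_abs_le] with x hx
  exact _root_.abs_le.1 hx

theorem moranTail_one (h : MoranData b p t M)
    (hspec : IsSpectralMeasure (moranMeasure b fun k => consecutiveDigits (p k) (t k))) :
    IsSpectralMeasure (moranTail b (fun k => consecutiveDigits (p k) (t k)) 1) := by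
  obtain ⟨Λ, hΛ⟩ := hspec.exists_spectrum
  have h1 := hspec.isProbabilityMeasure
  have h2 : IsProbabilityMeasure (moranTail b (fun k => consecutiveDigits (p k) (t k)) 1) :=
    (h.shift 1).spec.1
  exact ⟨h2, (h.shift 1).isCompact_support,
    exists_isSpectrum_of_factor (by have := h.two_le_card 0; omega)
      (div_ne_zero (h.step_ne_zero 0) (h.base_ne_zero 0)) (inv_ne_zero (h.base_ne_zero 0))
      h.fourierTransform_eq hΛ⟩

theorem dvd_of_isSpectralMeasure (h : MoranData b p t M) (hndvd : ¬ (p 0 : ℤ) ∣ t 1)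
    (hspec : IsSpectralMeasure (moranMeasure b fun k => consecutiveDigits (p k) (t k))) :
    (p 1 : ℤ) ∣ b 1 * t 0 := by
  obtain ⟨Λ, hΛ⟩ := hspec.exists_spectrum
  have h1 := hspec.isProbabilityMeasure
  obtain ⟨Λ', hc, h0, ho, he⟩ := exists_shift_zero_mem hΛ.countable hΛ.isOrthogonalSet
    hΛ.energy_eq_one
  set μ₁ := moranTail b (fun k => consecutiveDigits (p k) (t k)) 1 with hμ₁
  set μ₂ := moranTail (fun n => b (1 + n)) (fun k => consecutiveDigits (p (1 + k)) (t (1 + k))) 1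
    with hμ₂
  have hp1 : IsProbabilityMeasure μ₁ := (h.shift 1).spec.1
  have hp2 : IsProbabilityMeasure μ₂ := ((h.shift 1).shift 1).spec.1
  have hb0 := h.base_ne_zero 0
  have hb1 := h.base_ne_zero 1
  have ht0 := h.step_ne_zero 0
  have ht1 := h.step_ne_zero 1
  have hP0 : (p 0 : ℝ) ≠ 0 := by have := h.two_le_card 0; exact_mod_cast (by omega : p 0 ≠ 0)
  have hP1 : (p 1 : ℝ) ≠ 0 := by have := h.two_le_card 1; exact_mod_cast (by omega : p 1 ≠ 0)
  have hpr1 : IsProbabilityMeasure (μ₁.map ((b 0 : ℝ)⁻¹ * ·)) :=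
    Measure.isProbabilityMeasure_map (measurable_const_mul _).aemeasurable
  have hpr2 : IsProbabilityMeasure (μ₂.map ((b 0 * b 1 : ℝ)⁻¹ * ·)) :=
    Measure.isProbabilityMeasure_map (measurable_const_mul _).aemeasurable
  have hφ : ∀ ξ, fourierTransform (moranMeasure b fun k => consecutiveDigits (p k) (t k)) ξ =
      dirichletMask (p 0) (t 0 / b 0 * ξ) *
        fourierTransform (μ₁.map ((b 0 : ℝ)⁻¹ * ·)) ξ := fun ξ => by
    rw [fourierTransform_map_mul, h.fourierTransform_eq]
  have hψ : ∀ ξ, fourierTransform (μ₁.map ((b 0 : ℝ)⁻¹ * ·)) ξ =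
      dirichletMask (p 1) (t 1 / (b 0 * b 1) * ξ) *
        fourierTransform (μ₂.map ((b 0 * b 1 : ℝ)⁻¹ * ·)) ξ := fun ξ => by
    rw [fourierTransform_map_mul, fourierTransform_map_mul, hμ₁, moranTail,
      (h.shift 1).fourierTransform_eq]
    congr 2 <;> simp only [add_zero] <;> field_simp
  rcases exists_lattice_relation (h.two_le_card 0) (h.two_le_card 1) (div_ne_zero ht0 hb0)
    (div_ne_zero ht1 (mul_ne_zero hb0 hb1)) hφ hψ (fun T hT => hT.energy_le_one)
    (fun T hT => hT.energy_le_one) (continuous_fourierTransform _)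
    (by rw [fourierTransform_zero]; exact one_ne_zero) hc h0 ho he with
    ⟨x, m, n, hm, hn⟩ | ⟨x, m, n, hm, hn⟩
  -- Eliminating `x` gives t₁ m p₁ = b₁ t₀ (1 + p₁ n), and 1 + p₁ n is prime to p₁.
  · have hx : x = m * b 0 / t 0 := by rw [← hm]; field_simp
    rw [hx] at hn
    field_simp at hn
    have hz : t 1 * m * p 1 = b 1 * t 0 * (1 + p 1 * n) := by exact_mod_cast hn
    have hcop : IsCoprime (p 1 : ℤ) (1 + p 1 * n) := ⟨-n, 1, by ring⟩
    exact hcop.dvd_of_dvd_mul_right ⟨t 1 * m, by rw [← hz]; ring⟩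
  -- The other relation gives t₀ n b₁ p₀ = t₁ (1 + p₀ m), hence p₀ ∣ t₁.
  · exfalso
    have hx : x = n * (b 0 * b 1) / t 1 := by rw [← hn]; field_simp
    rw [hx] at hm
    field_simp at hm
    have hz : t 0 * n * b 1 * p 0 = t 1 * (1 + p 0 * m) := by exact_mod_cast hm
    have hcop : IsCoprime (p 0 : ℤ) (1 + p 0 * m) := ⟨-m, 1, by ring⟩
    exact hndvd (hcop.dvd_of_dvd_mul_right ⟨t 0 * n * b 1, by rw [← hz]; ring⟩)

theorem isSpectralMeasure_moranTail (h : MoranData b p t M)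
    (hspec : IsSpectralMeasure (moranMeasure b fun k => consecutiveDigits (p k) (t k))) (k : ℕ) :
    IsSpectralMeasure (moranTail b (fun k => consecutiveDigits (p k) (t k)) k) := by
  induction k with
  | zero => simpa [moranTail] using hspec
  | succ k ih =>
    have h1 := (h.shift k).moranTail_one ih
    simpa only [moranTail, ← add_assoc] using h1

end MoranData

theorem mainTheorem2 (b : ℕ → ℤ) (p : ℕ → ℕ) (t : ℕ → ℤ)
    (hb : ∀ k, 2 ≤ |b k|) (hp : ∀ k, 2 ≤ p k) (ht : ∀ k, 1 ≤ |t k|)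
    (hbdd : ∃ M : ℤ, ∀ k, |(p k : ℤ) * t k| ≤ M)
    (hndvd : ∀ k, ¬ (p k : ℤ) ∣ t (k + 1))
    (hspec : IsSpectralMeasure (moranMeasure b fun k => consecutiveDigits (p k) (t k))) :
    (∀ k, (p (k + 1) : ℤ) ∣ b (k + 1) * t k) ∧
      ∀ k, 1 ≤ k →
        IsSpectralMeasure (moranTail b (fun n => consecutiveDigits (p n) (t n)) k) := by
  obtain ⟨M, hM⟩ := hbdd
  have h : MoranData b p t M := ⟨hb, hp, ht, hM⟩
  exact ⟨fun k => (h.shift k).dvd_of_isSpectralMeasure (hndvd k)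
    (h.isSpectralMeasure_moranTail hspec k), fun k _ => h.isSpectralMeasure_moranTail hspec k⟩
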